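/- For a set $A$, let $[A]^{\aleph_0}$ be the family of all countably infinite subsets of $A$. A family $C\subseteq[A]^{\aleph_0}$ is club if every element of $[A]^{\aleph_0}$ is contained in an element of $C$ and $\bigcup_{i<\omega}U_i\in C$ whenever $U_0\subseteq U_1\subseteq\cdots$ are elements of $C$; a family $S\subseteq[A]^{\aleph_0}$ is stationary in $[A]^{\aleph_0}$ if $S\cap C\neq\emptyset$ for every club $C\subseteq[A]^{\aleph_0}$. Let $\mathcal L^{\aleph_0}_{stat}$ be the extension of first-order logic (with equality) by monadic second-order variables $X,Y,\dots$, ranging over the countably infinite subsets of the underlying set of the structure, by atomic formulas $x\mathrel{\varepsilon}X$ (interpreted as membership), and by a single second-order quantifier $stat$ (second-order variables are bound by no other quantifier), where, for a structure $\mathfrak A$ with underlying set $A$, $\mathfrak A\models stat\,X\,\varphi[X,\dots]$ holds if and only if $\{U\in[A]^{\aleph_0} : \mathfrak A\models\varphi[U,\dots]\}$ is stationary in $[A]^{\aleph_0}$. For a substructure $\mathfrak B$ (with underlying set $B$) of $\mathfrak A$, write $\mathfrak B\prec^-_{\mathcal L^{\aleph_0}_{stat}}\mathfrak A$ if for every $\mathcal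 L^{\aleph_0}_{stat}$-formula $\varphi(x_0,\dots,x_{n-1})$ without free second-order variables and all $b_0,\dots,b_{n-1}\in B$ we have $\mathfrak B\models\varphi[b_0,\dots,b_{n-1}]$ if and only if $\mathfrak A\models\varphi[b_0,\dots,b_{n-1}]$. Let $\mathsf{SDLS}^-(\mathcal L^{\aleph_0}_{stat},{<}\aleph_2)$ be the assertion: for every uncountable first-order structure $\mathfrak A$ in a countable signature there is a substructure $\mathfrak B$ of $\mathfrak A$ of cardinality $<\aleph_2$ such that $\mathfrak B\prec^-_{\mathcal L^{\aleph_0}_{stat}}\mathfrak A$. **Theorem.** $\mathsf{SDLS}^-(\mathcal L^{\aleph_0}_{stat},{<}\aleph_2)$ implies $2^{\aleph_0}\leq\aleph_2$. -/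

import Mathlib

open Cardinal

universe u v w

/-- `[A]^{ℵ₀}`: the family of countably infinite subsets of `A`. -/
def countablyInfiniteSets (A : Type w) : Set (Set A) :=
  {U | U.Countable ∧ U.Infinite}

/-- `C` is a club subset of `[A]^{ℵ₀}`: it consists of countably infinite subsets of `A`, it is
cofinal in `[A]^{ℵ₀}` with respect to inclusion, and it is closed under unions of increasing
`ω`-chains. -/
structure IsClubInCountable {A : Type w} (C : Set (Set A)) : Prop where
  subset : C ⊆ countablyInfiniteSets A
  unbounded : ∀ V ∈ countablyInfiniteSets A, ∃ U ∈ C, V ⊆ U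
  closed : ∀ U : ℕ → Set A, Monotone U → (∀ i, U i ∈ C) → (⋃ i, U i) ∈ C

/-- `S` is a stationary subset of `[A]^{ℵ₀}`: it meets every club subset of `[A]^{ℵ₀}`. -/
def IsStationaryInCountable {A : Type w} (S : Set (Set A)) : Prop :=
  S ⊆ countablyInfiniteSets A ∧ ∀ C : Set (Set A), IsClubInCountable C → (S ∩ C).Nonempty

/-- Formulas of stationary logic over the signature `L`, whose free first-order variables are among
`x_0, …, x_{n-1}` and whose free second-order variables are among `X_0, …, X_{m-1}`. A quantifier
binds the last variable of its kind in the formula that it is applied to. The remaining connectives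
and the existential quantifier are the usual classical abbreviations. -/
inductive StatFormula (L : FirstOrder.Language.{u, v}) : ℕ → ℕ → Type (max u v)
  | falsum {n m : ℕ} : StatFormula L n m
  | equal {n m : ℕ} (t₁ t₂ : L.Term (Fin n)) : StatFormula L n m
  | rel {n m k : ℕ} (R : L.Relations k) (ts : Fin k → L.Term (Fin n)) : StatFormula L n m
  | mem {n m : ℕ} (x : Fin n) (X : Fin m) : StatFormula L n m
  | imp {n m : ℕ} (φ ψ : StatFormula L n m) : StatFormula L n m
  | all {n m : ℕ} (φ : StatFormula L (n + 1) m) : StatFormula L n m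
  | stat {n m : ℕ} (φ : StatFormula L n (m + 1)) : StatFormula L n m

/-- Satisfaction of a formula of stationary logic in the structure `A`, where `a` interprets the
free first-order variables and `V` the free second-order variables. -/
def StatFormula.Realize {L : FirstOrder.Language.{u, v}} {A : Type w} [L.Structure A] :
    {n m : ℕ} → StatFormula L n m → (Fin n → A) → (Fin m → Set A) → Prop
  | _, _, .falsum, _, _ => False
  | _, _, .equal t₁ t₂, a, _ => t₁.realize a = t₂.realize a
  | _, _, .rel R ts, a, _ => FirstOrder.Language.Structure.RelMap R fun i => (ts i).realize a
  | _, _, .mem x X, a, V => a x ∈ V X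
  | _, _, .imp φ ψ, a, V => φ.Realize a V → ψ.Realize a V
  | _, _, .all φ, a, V => ∀ b : A, φ.Realize (Fin.snoc a b) V
  | _, _, .stat φ, a, V =>
      IsStationaryInCountable {U | U ∈ countablyInfiniteSets A ∧ φ.Realize a (Fin.snoc V U)}

/-- `B ≺⁻ A` for stationary logic: `B` and `A` satisfy the same formulas without free second-order
variables, with parameters from `B`. -/
def IsStatElementaryMinus {L : FirstOrder.Language.{u, v}} {A : Type w} [L.Structure A]
    (B : L.Substructure A) : Prop :=
  ∀ (n : ℕ) (φ : StatFormula L n 0) (b : Fin n → B),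
    φ.Realize b Fin.elim0 ↔ φ.Realize (fun i => (b i : A)) Fin.elim0

/-- The strong downward Löwenheim–Skolem principle `SDLS⁻(L_stat^{ℵ₀}, < κ)`: every uncountable
structure `A` in a countable signature has a substructure `B` of cardinality `< κ` such that
`B ≺⁻ A` for stationary logic. -/
def SDLSMinus (κ : Cardinal.{w}) : Prop :=
  ∀ (L : FirstOrder.Language.{u, v}) (A : Type w) [L.Structure A], Countable L.Symbols → Uncountable A →
    ∃ B : L.Substructure A, #B < κ ∧ IsStatElementaryMinus B

/-!
The proof bounds `2^{ℵ₀}` from above by the number of projections of the members of a club.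

For each `β < ω₂` fix an injection of `β` into `ω₁`; it writes `β` as the union of a continuous
increasing chain of `ℵ₁` many countable sets, the layers of `β` (`layer`). All together there are
`ℵ₂` many layers, and the infinite layers of `β` form a club in `[β]^{ℵ₀}` when `β` is
uncountable.

Let `A` be a set of codes for all of its own countable subsets, with projections `π` onto `ω₂` and
`ρ` onto `ω₁`. If stationarily many countable `X ⊆ A` had a projection `π '' X` that is not a layer,
then `stat X` there is a code of `X` that satisfies the predicate "the coded set does not project to
a layer". The predicate is part of the structure and the substructure `B` given by `SDLSMinus` is
closed under decoding, so `B` has stationarily many such subsets too. A second sentence makes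
`ρ '' B` unbounded in `ω₁`, and with enumerations of the layers among the functions of the structure
this makes `π '' B` a proper initial segment of `ω₂`. But almost all countable subsets of `B` then
project to layers of this segment, a contradiction. Hence there is a club in `[A]^{ℵ₀}` all of whose
members project to layers (`SDLSMinus.exists_club_image_eq_layer`).

On the other hand, the members of any club in `[A]^{ℵ₀}` have at least `2^{ℵ₀}` many projections to
`ω₂`, as Baumgartner and Taylor showed (`exists_injective_images_of_club`). The members of the
club are arranged along finite sequences in `ω₂`, and a perfect tree of sequences is thinned out
according to the bits of a real; the determinacy of an open game provides at each stage a point that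
may be decided either way.
-/

open Set

/-! ### Projections of clubs -/

section Tree
variable {W : Type w}

/-- Sets of cardinality at most `ℵ₁`. On a set of cardinality `ℵ₂` these form a proper ideal that is
closed under unions of `ℵ₁` many sets, which is all that the splitting argument uses. -/
def IsSmallSet (s : Set W) : Prop := #s ≤ ℵ₁

theorem IsSmallSet.mono {s t : Set W} (h : IsSmallSet t) (hst : s ⊆ t) : IsSmallSet s :=
  (mk_le_mk_of_subset hst).trans h

theorem Set.Countable.isSmallSet {s : Set W} (h : s.Countable) : IsSmallSet s :=
  ((le_aleph0_iff_set_countable.2 h).trans (aleph0_le_aleph 1))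

theorem isSmallSet_biUnion {Γ : Set W} (hΓ : IsSmallSet Γ) {f : Γ → Set W}
    (hf : ∀ γ, IsSmallSet (f γ)) : IsSmallSet (⋃ γ, f γ) := by
  refine (mk_iUnion_le f).trans ?_
  refine (mul_le_mul' hΓ (ciSup_le' hf)).trans ?_
  exact (mul_eq_self (aleph0_le_aleph 1)).le

/-- A set of finite sequences in which every member has more than `ℵ₁` many one-step extensions.
Sequences are lists with the latest entry at the head. No root is
singled out and closure under initial segments is not required, so the position in a tree can
advance while the tree stays the same. -/
def IsPerfectTree (T : Set (List W)) : Prop := ∀ l ∈ T, ¬ IsSmallSet {x | x :: l ∈ T}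

/-- A winning strategy, from the position `l`, for the first player of the following open game on
the tree `T`: at each step the first player forbids a small set of entries, and the second player
extends the position inside `T` by an entry that is not forbidden; the first player wins when the
position reaches `P`. The game is open for the first player, so a strategy is a well-founded tree.
It carries data so that many strategies can be followed along one common play. -/
inductive HitStrategy (T : Set (List W)) (P : Set (List W)) : List W → Type w
  | done {l : List W} (h : l ∈ P) : HitStrategy T P l
  | step {l : List W} (s : Set W) (hs : IsSmallSet s)
      (next : ∀ x, x ∉ s → x :: l ∈ T → HitStrategy T P (x :: l)) : HitStrategy T P l

/-- Determinacy of the game: if the first player has no winning strategy, then the positions without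
one form a perfect tree that avoids `P`. -/
theorem exists_perfect_subtree_of_isEmpty {T P : Set (List W)} {r : List W} (hr : r ∈ T)
    (h : IsEmpty (HitStrategy T P r)) :
    ∃ T' ⊆ T, IsPerfectTree T' ∧ r ∈ T' ∧ ∀ l ∈ T', l ∉ P := by
  refine ⟨{l | l ∈ T ∧ IsEmpty (HitStrategy T P l)}, fun l hl => hl.1, ?_, ⟨hr, h⟩, ?_⟩
  · rintro l ⟨-, hl⟩ hs
    refine hl.false (.step _ hs fun x hx hxT => ?_)
    exact Classical.choice (not_isEmpty_iff.1 fun he => hx ⟨hxT, he⟩)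
  · rintro l ⟨-, hl⟩ hP
    exact hl.false (.done hP)

/-- Only countably many points `γ` can be forced into `⋃ₙ N (lₙ)` along plays `l₀, l₁, …` on `T`:
given strategies for `ℵ₁` many of them, some play obeys all the strategies at once, since the union
of `ℵ₁` many small sets is small, and then the countable set `⋃ₙ N (lₙ)` contains all these
points. -/
theorem countable_setOf_nonempty_hitStrategy {T : Set (List W)} (hT : IsPerfectTree T)
    {N : List W → Set W} (hN : ∀ l, (N l).Countable) (hmono : ∀ x l, N l ⊆ N (x :: l))
    {r : List W} (hr : r ∈ T) :
    {γ | Nonempty (HitStrategy T {l | γ ∈ N l} r)}.Countable := by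
  classical
  by_contra hunc
  obtain ⟨Γ, hΓsub, hΓ⟩ : ∃ Γ ⊆ {γ | Nonempty (HitStrategy T {l | γ ∈ N l} r)}, #Γ = ℵ₁ := by
    refine le_mk_iff_exists_subset.1 (aleph_one_le_iff.2 ?_)
    rwa [← not_le, le_aleph0_iff_set_countable]
  -- A state is a position together with a strategy from there for every `γ ∈ Γ`.
  let State := Σ l : T, ∀ γ : Γ, HitStrategy T {l | γ.1 ∈ N l} l.1
  let bad (q : State) (γ : Γ) : Set W := match q.2 γ with
    | .done _ => ∅
    | .step s _ _ => s
  have hbad (q : State) (γ : Γ) : IsSmallSet (bad q γ) := by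
    dsimp only [bad]
    cases q.2 γ with
    | done h => exact countable_empty.isSmallSet
    | step s hs next => exact hs
  have hex (q : State) : ∃ x, x :: q.1.1 ∈ T ∧ ∀ γ, x ∉ bad q γ := by
    by_contra! hcon
    refine hT q.1.1 q.1.2 ((isSmallSet_biUnion hΓ.le (hbad q)).mono fun x hx => ?_)
    exact mem_iUnion.2 (hcon x hx)
  choose pick hpickT hpick using hex
  -- Following the strategy for `γ` along the chosen move; a game that is won stays won.
  let adv (q : State) (γ : Γ) (t : HitStrategy T {l | γ.1 ∈ N l} q.1.1)
      (ht : t = q.2 γ) : HitStrategy T {l | γ.1 ∈ N l} (pick q :: q.1.1) :=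
    match t, ht with
    | .done h, _ => .done (hmono _ _ h)
    | .step s hs next, ht => next (pick q) (by have := hpick q γ; simpa [bad, ← ht] using this)
        (hpickT q)
  let nxt (q : State) : State := ⟨⟨pick q :: q.1.1, hpickT q⟩, fun γ => adv q γ (q.2 γ) rfl⟩
  have key (γ : Γ) : ∀ (l : List W) (t : HitStrategy T {l | γ.1 ∈ N l} l) (q : State)
      (hq : q.1.1 = l), hq ▸ q.2 γ = t → ∃ n, γ.1 ∈ N (nxt^[n] q).1.1 := by
    intro l t
    induction t with
    | done h => rintro q rfl -; exact ⟨0, h⟩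
    | @step l s hs next ih =>
      rintro q rfl ht
      have hx : pick q ∉ s := by have := hpick q γ; simpa [bad, ht] using this
      obtain ⟨n, hn⟩ := ih (pick q) hx (hpickT q) (nxt q) rfl (by
        have : ∀ t (h : t = q.2 γ), t = .step s hs next →
            adv q γ t h = next (pick q) hx (hpickT q) := by
          rintro t h rfl; rfl
        exact this _ rfl ht)
      exact ⟨n + 1, hn⟩
  let q₀ : State := ⟨⟨r, hr⟩, fun γ => Classical.choice (hΓsub γ.2)⟩
  have hcount : Γ.Countable := by
    refine (countable_iUnion fun n => hN (nxt^[n] q₀).1.1).mono fun γ hγ => mem_iUnion.2 ?_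
    exact key ⟨γ, hγ⟩ _ _ q₀ rfl rfl
  rw [← le_aleph0_iff_set_countable, hΓ, ← not_lt] at hcount
  exact hcount aleph0_lt_aleph_one

/-- The splitting step: some point `γ` can be put into the final set by appending it to `r`, and can
also be kept out of it by passing to a perfect subtree through `r`. -/
theorem exists_cons_mem_and_avoiding_subtree {T : Set (List W)} (hT : IsPerfectTree T)
    {N : List W → Set W} (hN : ∀ l, (N l).Countable) (hmono : ∀ x l, N l ⊆ N (x :: l))
    {r : List W} (hr : r ∈ T) :
    ∃ γ, γ :: r ∈ T ∧ ∃ T' ⊆ T, IsPerfectTree T' ∧ r ∈ T' ∧ ∀ l ∈ T', γ ∉ N l := by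
  by_contra! hcon
  refine hT r hr ((countable_setOf_nonempty_hitStrategy hT hN hmono hr).isSmallSet.mono ?_)
  intro γ hγ
  by_contra hne
  obtain ⟨T', h₁, h₂, h₃, h₄⟩ := exists_perfect_subtree_of_isEmpty hr (not_nonempty_iff.1 hne)
  obtain ⟨l, hl, hl'⟩ := hcon γ hγ T' h₁ h₂ h₃
  exact h₄ l hl hl'

/-- A club contains a tree of sets, indexed by finite sequences in `W`, that increases along
extensions and whose projections contain the entries of the index. -/
theorem exists_list_tree {A : Type w} {C : Set (Set A)}
    (hC : IsClubInCountable C) (π : A → W) (hπ : Function.Surjective π) [Infinite A] :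
    ∃ M : List W → Set A, (∀ l, M l ∈ C) ∧ (∀ x l, M l ⊆ M (x :: l)) ∧
      ∀ x l, x ∈ π '' M (x :: l) := by
  obtain ⟨σ, hσ⟩ := hπ.hasRightInverse
  have hext (U : C) (x : W) : ∃ U' : C, U.1 ⊆ U'.1 ∧ σ x ∈ U'.1 := by
    obtain ⟨hc, hi⟩ := hC.subset U.2
    obtain ⟨U', hU', hsub⟩ := hC.unbounded (insert (σ x) U.1)
      ⟨hc.insert _, hi.mono (subset_insert _ _)⟩
    exact ⟨⟨U', hU'⟩, (subset_insert _ _).trans hsub, hsub (mem_insert _ _)⟩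
  choose ext hext₁ hext₂ using hext
  obtain ⟨U₀, hU₀, -⟩ := hC.unbounded (range (Infinite.natEmbedding A))
    ⟨countable_range _, infinite_range_of_injective (Infinite.natEmbedding A).injective⟩
  let M : List W → C := fun l => l.foldr (fun x U => ext U x) ⟨U₀, hU₀⟩
  exact ⟨fun l => M l, fun l => (M l).2, fun x l => hext₁ (M l) x,
    fun x l => ⟨σ x, hext₂ (M l) x, hσ x⟩⟩

/-- A form of a theorem of Baumgartner and Taylor: if `π` maps `A` onto a set of cardinality at
least `ℵ₂`, then the members of a club in `[A]^{ℵ₀}` have at least `2^{ℵ₀}` many images under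
`π`. -/
theorem exists_injective_images_of_club {A : Type w} {C : Set (Set A)}
    (hC : IsClubInCountable C) (π : A → W) (hπ : Function.Surjective π) (hW : ¬ #W ≤ ℵ₁) :
    ∃ F : (ℕ → Bool) → Set W, Function.Injective F ∧ ∀ b, ∃ X ∈ C, F b = π '' X := by
  classical
  have hWinf : Infinite W := by
    rw [infinite_iff]
    exact (aleph0_le_aleph 1).trans (not_le.1 hW).le
  have : Infinite A := Infinite.of_surjective π hπ
  obtain ⟨M, hMC, hMmono, hMmem⟩ := exists_list_tree hC π hπ
  have hcount (l) : (π '' M l).Countable := (hC.subset (hMC l)).1.image π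
  -- A state is a perfect tree with a marked position. On the bit `true` the point `γ` is appended
  -- to the position, on `false` the tree is thinned out so as to avoid `γ`, with the same position.
  let State := {q : List W × Set (List W) // q.1 ∈ q.2 ∧ IsPerfectTree q.2}
  have hsplit (q : State) := exists_cons_mem_and_avoiding_subtree q.2.2 hcount
    (fun x l => image_mono (hMmono x l)) q.2.1
  choose γ hγ T' hT'sub hT' hT'r hT'γ using hsplit
  let nxt (c : Bool) (q : State) : State :=
    match c with
    | true => ⟨(γ q :: q.1.1, q.1.2), hγ q, q.2.2⟩
    | false => ⟨(q.1.1, T' q), hT'r q, hT' q⟩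
  let q₀ : State := ⟨([], univ), mem_univ _, fun l _ h => hW (by
    simpa [IsSmallSet] using h)⟩
  let st (b : ℕ → Bool) (n : ℕ) : State := Nat.rec q₀ (fun k q => nxt (b k) q) n
  have hst (b n) : st b (n + 1) = nxt (b n) (st b n) := rfl
  have hM (b) : Monotone fun n => M (st b n).1.1 := by
    refine monotone_nat_of_le_succ fun n => ?_
    rw [hst]
    cases b n
    · exact le_rfl
    · exact hMmono _ _
  have hTanti (b) : Antitone fun n => (st b n).1.2 := by
    refine antitone_nat_of_succ_le fun n => ?_
    rw [hst]
    cases b n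
    · exact hT'sub _
    · exact le_rfl
  let X (b : ℕ → Bool) : Set A := ⋃ n, M (st b n).1.1
  have hagree (b b' : ℕ → Bool) (n : ℕ) (h : ∀ k < n, b k = b' k) : st b n = st b' n := by
    induction n with
    | zero => rfl
    | succ n ih => rw [hst, hst, h n n.lt_succ_self, ih fun k hk => h k (hk.trans n.lt_succ_self)]
  -- At the first difference of `b` and `b'` both have the same `γ`, which separates the two unions.
  have hne (b b' : ℕ → Bool) (n : ℕ) (h : ∀ k < n, b k = b' k) (hb : b n = true)
      (hb' : b' n = false) : π '' X b ≠ π '' X b' := by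
    intro heq
    have h₁ : γ (st b n) ∈ π '' X b := by
      refine image_mono (subset_iUnion _ (n + 1)) ?_
      rw [hst, hb]
      exact hMmem _ _
    rw [heq, hagree b b' n h, image_iUnion, mem_iUnion] at h₁
    obtain ⟨m, hm⟩ := h₁
    have hm' := image_mono (hM b' (le_max_left m (n + 1))) hm
    refine hT'γ (st b' n) _ ?_ hm'
    have := hTanti b' (le_max_right m (n + 1)) (st b' (max m (n + 1))).2.1
    simp only [hst, hb'] at this
    exact this
  refine ⟨fun b => π '' X b, fun b b' heq => ?_, fun b => ⟨X b, hC.closed _ (hM b) fun n => hMC _,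
    rfl⟩⟩
  by_contra hbb
  have hex : ∃ n, b n ≠ b' n := Function.ne_iff.1 hbb
  have hmin (k) (hk : k < Nat.find hex) : b k = b' k := not_not.1 (Nat.find_min hex hk)
  have hspec := Nat.find_spec hex
  cases h : b (Nat.find hex) <;> cases h' : b' (Nat.find hex)
  · exact hspec (h.trans h'.symm)
  · exact hne b' b _ (fun k hk => (hmin k hk).symm) h' h heq.symm
  · exact hne b b' _ hmin h h' heq
  · exact hspec (h.trans h'.symm)

end Tree

/-! ### Reflection of two sentences of stationary logic -/

namespace StatFormula
variable {L : FirstOrder.Language.{u, v}} {A : Type w} [L.Structure A] {n m : ℕ}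

/-- Negation. -/
def neg (φ : StatFormula L n m) : StatFormula L n m := .imp φ .falsum

/-- Conjunction. -/
def and (φ ψ : StatFormula L n m) : StatFormula L n m := neg (.imp φ (neg ψ))

/-- First-order existential quantification. -/
def ex (φ : StatFormula L (n + 1) m) : StatFormula L n m := neg (.all (neg φ))

theorem realize_neg (φ : StatFormula L n m) (a : Fin n → A) (V : Fin m → Set A) :
    (neg φ).Realize a V ↔ ¬ φ.Realize a V := by simp [neg, Realize]

theorem realize_and (φ ψ : StatFormula L n m) (a : Fin n → A) (V : Fin m → Set A) :
    (and φ ψ).Realize a V ↔ φ.Realize a V ∧ ψ.Realize a V := by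
  simp [and, realize_neg, Realize]

theorem realize_ex (φ : StatFormula L (n + 1) m) (a : Fin n → A) (V : Fin m → Set A) :
    (ex φ).Realize a V ↔ ∃ b, φ.Realize (Fin.snoc a b) V := by
  simp [ex, realize_neg, Realize]

end StatFormula

/-- The function symbols of `codeLanguage`: `code n` is unary, `init n` is binary. -/
inductive CodeFunctions : ℕ → Type u
  | code (n : ℕ) : CodeFunctions 1
  | init (n : ℕ) : CodeFunctions 2

/-- The relation symbols of `codeLanguage`: a unary `avoid`, and binary `coded` and `lt`. -/
inductive CodeRelations : ℕ → Type v
  | avoid : CodeRelations 1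
  | coded : CodeRelations 2
  | lt : CodeRelations 2

/-- The countable signature of the structures `codeStructure`. -/
def codeLanguage : FirstOrder.Language.{u, v} := ⟨CodeFunctions, CodeRelations⟩

theorem countable_codeLanguage_symbols : Countable codeLanguage.{u, v}.Symbols := by
  have h₁ : Countable (Σ l, CodeFunctions.{u} l) := by
    refine Function.Surjective.countable
      (f := Sum.elim (fun n : ℕ => ⟨1, .code n⟩) (fun n : ℕ => ⟨2, .init n⟩)) ?_
    rintro ⟨_, n | n⟩
    exacts [⟨.inl n, rfl⟩, ⟨.inr n, rfl⟩]
  have h₂ : Countable (Σ l, CodeRelations.{v} l) := by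
    refine Function.Surjective.countable
      (f := ![⟨1, .avoid⟩, ⟨2, .coded⟩, ⟨2, .lt⟩]) ?_
    rintro ⟨_, _ | _ | _⟩
    exacts [⟨0, rfl⟩, ⟨1, rfl⟩, ⟨2, rfl⟩]
  exact inferInstanceAs (Countable ((Σ l, CodeFunctions.{u} l) ⊕ Σ l, CodeRelations.{v} l))

/-- An element `s` codes the countable set `range (code s)`; `coded` is membership in the coded set,
`avoid` picks out the codes in `R`. The functions `init n` are arbitrary, and make substructures
closed under countably many binary operations. -/
abbrev codeStructure {A : Type w} (code : A → ℕ → A) (init : ℕ → A → A → A) (R : Set A)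
    (lt : A → A → Prop) : codeLanguage.{u, v}.Structure A where
  funMap
    | CodeFunctions.code n, x => code (x 0) n
    | CodeFunctions.init n, x => init n (x 0) (x 1)
  RelMap
    | CodeRelations.avoid, x => x 0 ∈ R
    | CodeRelations.coded, x => x 0 ∈ range (code (x 1))
    | CodeRelations.lt, x => lt (x 0) (x 1)

/-- `stat X` there is a code of `X` in `R`. -/
def codedSentence : StatFormula codeLanguage.{u, v} 0 0 :=
  .stat <| .ex <| .and (.rel CodeRelations.avoid ![.var 0]) <| .all <|
    .and (.imp (.mem 1 0) (.rel CodeRelations.coded ![.var 1, .var 0]))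
      (.imp (.rel CodeRelations.coded ![.var 1, .var 0]) (.mem 1 0))

/-- `stat X` there is a bound for `X` with respect to `lt`. -/
def boundedSentence : StatFormula codeLanguage.{u, v} 0 0 :=
  .stat <| .ex <| .all <| .imp (.mem 1 0) (.rel CodeRelations.lt ![.var 1, .var 0])

/-- What is used of `SDLSMinus`: the sentences `codedSentence` and `boundedSentence` reflect to a
set of cardinality `< κ` that is closed under the given functions. Closure under `code` makes the
set coded by an element of `B` a subset of `B`, so that codes have the same meaning in `B` as in
`A`. -/
theorem SDLSMinus.exists_reflecting_set {κ : Cardinal.{w}} (h : SDLSMinus.{u, v, w} κ) {A : Type w}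
    [Uncountable A] (code : A → ℕ → A) (init : ℕ → A → A → A) (R : Set A) (lt : A → A → Prop) :
    ∃ B : Set A, #B < κ ∧ (∀ s ∈ B, ∀ n, code s n ∈ B) ∧
      (∀ a ∈ B, ∀ b ∈ B, ∀ n, init n a b ∈ B) ∧
      (IsStationaryInCountable {X : Set A | X ∈ countablyInfiniteSets A ∧
          ∃ s ∈ R, X = range (code s)} →
        IsStationaryInCountable {X : Set B | X ∈ countablyInfiniteSets B ∧
          ∃ s : B, s.1 ∈ R ∧ Subtype.val '' X = range (code s)}) ∧
      (IsStationaryInCountable {X : Set A | X ∈ countablyInfiniteSets A ∧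
          ∃ i, ∀ j ∈ X, lt j i} →
        IsStationaryInCountable {X : Set B | X ∈ countablyInfiniteSets B ∧
          ∃ i : B, ∀ j ∈ X, lt j.1 i.1}) := by
  let _ := codeStructure.{u, v} code init R lt
  obtain ⟨B, hB, hel⟩ := h codeLanguage.{u, v} A countable_codeLanguage_symbols inferInstance
  have hcode : ∀ s ∈ B, ∀ n, code s n ∈ B := fun s hs n =>
    B.fun_mem (CodeFunctions.code n : codeLanguage.{u, v}.Functions 1) ![s] (by simpa)
  have hinit : ∀ a ∈ B, ∀ b ∈ B, ∀ n, init n a b ∈ B := fun a ha b hb n =>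
    B.fun_mem (CodeFunctions.init n : codeLanguage.{u, v}.Functions 2) ![a, b] (by
      intro i; fin_cases i <;> simpa)
  refine ⟨B, hB, hcode, hinit, ?_, ?_⟩
  · intro hA
    have := (hel 0 codedSentence Fin.elim0).2 (by
      simp only [codedSentence, StatFormula.Realize]
      convert hA using 5 with X
      simp only [StatFormula.realize_and, StatFormula.realize_ex, StatFormula.Realize]
      refine exists_congr fun s => and_congr Iff.rfl ?_
      rw [Set.ext_iff]
      exact forall_congr' fun x => iff_def.symm)
    simp only [codedSentence, StatFormula.Realize] at this
    refine (congrArg IsStationaryInCountable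
      (Set.ext fun X : Set B => and_congr_right fun _ => ?_)).mp this
    simp only [StatFormula.realize_and, StatFormula.realize_ex, StatFormula.Realize]
    refine exists_congr fun s => and_congr Iff.rfl ?_
    refine (forall_congr' fun x : B => iff_def.symm).trans ?_
    change (∀ x : B, x ∈ X ↔ x.1 ∈ range (code s)) ↔ _
    constructor
    · intro hX
      ext y
      constructor
      · rintro ⟨x, hx, rfl⟩
        exact (hX x).1 hx
      · rintro ⟨n, rfl⟩
        exact ⟨⟨_, hcode s s.2 n⟩, (hX _).2 ⟨n, rfl⟩, rfl⟩
    · intro hX x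
      rw [← hX]
      simp
  · intro hA
    have := (hel 0 boundedSentence Fin.elim0).2 (by
      simp only [boundedSentence, StatFormula.Realize]
      convert hA using 5 with X
      simp only [StatFormula.realize_ex, StatFormula.Realize]
      rfl)
    simp only [boundedSentence, StatFormula.Realize] at this
    refine (congrArg IsStationaryInCountable
      (Set.ext fun X : Set B => and_congr_right fun _ => ?_)).mp this
    simp only [StatFormula.realize_ex, StatFormula.Realize]
    rfl

/-! ### Layers of initial segments of `ω₂` -/

section WellOrders
variable {W Ω : Type w} [LinearOrder W] [LinearOrder Ω]

/-- The part of the initial segment below `β` that `f β` sends below `i`. When `f β` injects the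
initial segment into `ω₁`, this is a continuous increasing chain of countable sets with union the
initial segment. -/
def layer (f : W → W → Ω) (β : W) (i : Ω) : Set W := {η | η < β ∧ f β η < i}

theorem countable_layer {f : W → W → Ω} (hf : ∀ β, InjOn (f β) (Iio β))
    (hΩ : ∀ i : Ω, (Iic i).Countable) (β : W) (i : Ω) : (layer f β i).Countable := by
  refine MapsTo.countable_of_injOn (t := Iic i) (f := f β) (fun η hη => hη.2.le) ?_ (hΩ i)
  exact (hf β).mono fun η hη => hη.1

theorem exists_gt_of_uncountable (hΩ : ∀ i : Ω, (Iic i).Countable) {s : Set Ω}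
    (hs : ¬ s.Countable) (i : Ω) : ∃ j ∈ s, i < j := by
  by_contra! hcon
  exact hs ((hΩ i).mono hcon)

theorem exists_forall_lt_of_countable [Uncountable Ω] (hΩ : ∀ i : Ω, (Iic i).Countable) {s : Set Ω}
    (hs : s.Countable) : ∃ i, ∀ j ∈ s, j < i := by
  by_contra! hcon
  refine not_countable_univ (α := Ω) ((hs.biUnion fun j _ => hΩ j).mono fun i _ => ?_)
  obtain ⟨j, hj, hij⟩ := hcon i
  exact mem_biUnion hj hij

theorem exists_isLUB_of_countable [Uncountable Ω] [WellFoundedLT Ω]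
    (hΩ : ∀ i : Ω, (Iic i).Countable) {s : Set Ω} (hs : s.Countable) : ∃ i, IsLUB s i := by
  obtain ⟨i, hi⟩ := exists_forall_lt_of_countable hΩ hs
  have hne : (upperBounds s).Nonempty := ⟨i, fun j hj => (hi j hj).le⟩
  exact ⟨wellFounded_lt.min _ hne, wellFounded_lt.min_mem _ hne,
    fun j hj => wellFounded_lt.min_le hj⟩

/-- The pullback along a surjection `p` of the fact that almost every countable subset of an initial
segment is a layer. It is closed because the layers form a continuous chain, and unbounded because
countable subsets of `ω₁` are bounded. -/
theorem isClubInCountable_image_eq_layer [Uncountable Ω] [WellFoundedLT Ω]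
    (hΩ : ∀ i : Ω, (Iic i).Countable) {f : W → W → Ω} (hf : ∀ β, InjOn (f β) (Iio β))
    {B : Type w} {p : B → W} {β : W} (hp : range p = Iio β) :
    IsClubInCountable {X | X ∈ countablyInfiniteSets B ∧ ∃ i, p '' X = layer f β i} where
  subset := fun X hX => hX.1
  unbounded := by
    rintro V ⟨hVc, hVi⟩
    obtain ⟨i, hi⟩ := exists_forall_lt_of_countable hΩ ((hVc.image p).image (f β))
    have hV : p '' V ⊆ layer f β i := fun η hη =>
      ⟨by rw [← mem_Iio, ← hp]; exact image_subset_range _ _ hη, hi _ ⟨η, hη, rfl⟩⟩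
    have hsub : layer f β i ⊆ p '' univ := by
      rw [image_univ, hp]
      exact fun η hη => hη.1
    obtain ⟨t, -, ht⟩ : ∃ t ⊆ (univ : Set B), BijOn p t (layer f β i) :=
      SurjOn.exists_bijOn_subset hsub
    have htc : t.Countable :=
      MapsTo.countable_of_injOn ht.mapsTo ht.injOn (countable_layer hf hΩ β i)
    -- Adding preimages of the missing points of the layer to `V` suffices, with no iteration.
    refine ⟨V ∪ t, ⟨⟨hVc.union htc, hVi.mono subset_union_left⟩, i, ?_⟩, subset_union_left⟩
    rw [image_union, ht.image_eq, union_eq_right.2 hV]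
  closed := by
    intro U _ hU
    choose hUc i hi using fun n => hU n
    obtain ⟨j, hj⟩ := exists_isLUB_of_countable hΩ (countable_range i)
    refine ⟨⟨countable_iUnion fun n => (hUc n).1, (hUc 0).2.mono (subset_iUnion _ _)⟩, j, ?_⟩
    ext η
    simp only [image_iUnion, hi, mem_iUnion, layer, mem_ofPred_eq, lt_isLUB_iff hj,
      exists_range_iff, exists_and_left]

theorem exists_uncountable_wellOrder_countable_Iic :
    ∃ (Ω : Type w) (_ : LinearOrder Ω), WellFoundedLT Ω ∧ Uncountable Ω ∧
      #Ω = ℵ₁ ∧ ∀ i : Ω, (Iic i).Countable := by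
  refine ⟨(ℵ₁ : Cardinal.{w}).ord.ToType, inferInstance, inferInstance, ?_, mk_ord_toType _,
    fun i => ?_⟩
  · rw [← aleph0_lt_mk_iff, mk_ord_toType]
    exact aleph0_lt_aleph_one
  · have h : (Iio i).Countable := by
      rw [← le_aleph0_iff_set_countable, ← lt_aleph_one_iff]
      exact (mk_Iio_lt i (by simp)).trans_eq (mk_ord_toType _)
    rw [← Iio_insert]
    exact h.insert i

theorem exists_wellOrder_aleph_two :
    ∃ (W : Type w) (_ : LinearOrder W), WellFoundedLT W ∧ #W = ℵ_ 2 ∧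
      ∀ β : W, #(Iio β) ≤ ℵ₁ := by
  refine ⟨(ℵ_ 2 : Cardinal.{w}).ord.ToType, inferInstance, inferInstance, mk_ord_toType _,
    fun β => ?_⟩
  have h : #(Iio β) < ℵ_ 2 := (mk_Iio_lt β (by simp)).trans_eq (mk_ord_toType _)
  have h₂ : (ℵ_ 2 : Cardinal.{w}) = Order.succ ℵ₁ := by
    rw [succ_aleph, one_add_one_eq_two]
  exact Order.lt_succ_iff.1 (h.trans_eq h₂)

theorem exists_injOn_Iio {Ω : Type w} (hW : ∀ β : W, #(Iio β) ≤ ℵ₁) (hΩ : #Ω = ℵ₁) :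
    ∃ f : W → W → Ω, ∀ β, InjOn (f β) (Iio β) := by
  classical
  have hne : Nonempty Ω := mk_ne_zero_iff.1 (by rw [hΩ]; exact (aleph_pos 1).ne')
  have h (β : W) : ∃ g : W → Ω, InjOn g (Iio β) := by
    obtain ⟨e⟩ : Nonempty (Iio β ↪ Ω) := by
      rw [← Cardinal.le_def, hΩ]
      exact hW β
    refine ⟨fun η => if h : η < β then e ⟨η, h⟩ else hne.some, fun η hη ξ hξ heq => ?_⟩
    rw [mem_Iio] at hη hξ
    simp only [hη, hξ, dite_true] at heq
    exact congrArg Subtype.val (e.injective heq)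
  choose f hf using h
  exact ⟨f, hf⟩

theorem exists_eq_Iio_of_isLowerSet [WellFoundedLT W] {Y : Set W} (hY : IsLowerSet Y)
    (hne : Y ≠ Set.univ) : ∃ β, Y = Iio β := by
  have hc : Yᶜ.Nonempty := nonempty_compl.2 hne
  refine ⟨wellFounded_lt.min _ hc, ext fun η => ⟨fun hη => ?_, fun hη => ?_⟩⟩
  · by_contra hle
    exact wellFounded_lt.min_mem _ hc (hY (not_lt.1 hle) hη)
  · by_contra hnot
    exact wellFounded_lt.not_lt_min _ hnot hη

end WellOrders

/-! ### A club that projects to few sets -/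

/-- If the range of `ρ` is countable, a club of countable sets has all of that range as image under
`ρ`, so that no member of the club is strictly bounded by a value of `ρ`. -/
theorem not_countable_range_of_isStationary {B : Type w} {Ω : Type w} [LinearOrder Ω] (ρ : B → Ω)
    (h : IsStationaryInCountable
      {X : Set B | X ∈ countablyInfiniteSets B ∧ ∃ i, ∀ j ∈ X, ρ j < ρ i}) :
    ¬ (range ρ).Countable := by
  intro hc
  -- If `B` is finite, the empty family is a club, and nothing is stationary.
  obtain ⟨V, hV⟩ : (countablyInfiniteSets B).Nonempty := by
    by_contra hemp
    rw [not_nonempty_iff_eq_empty] at hemp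
    obtain ⟨X, -, hX⟩ := h.2 ∅ ⟨empty_subset _, fun V hV => by simp [hemp] at hV,
      fun U _ hU => (hU 0).elim⟩
    exact hX
  obtain ⟨t, -, ht⟩ : ∃ t ⊆ (univ : Set B), BijOn ρ t (range ρ) :=
    SurjOn.exists_bijOn_subset (by rw [SurjOn, image_univ])
  have htc : t.Countable := MapsTo.countable_of_injOn ht.mapsTo ht.injOn hc
  obtain ⟨X, ⟨-, i, hi⟩, -, hX⟩ := h.2 {X | X ∈ countablyInfiniteSets B ∧ t ⊆ X}
    ⟨fun X hX => hX.1,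
      fun U hU => ⟨U ∪ t, ⟨⟨hU.1.union htc, hU.2.mono subset_union_left⟩, subset_union_right⟩,
        subset_union_left⟩,
      fun U _ hU => ⟨⟨countable_iUnion fun n => (hU n).1.1,
        (hU 0).1.2.mono (subset_iUnion _ _)⟩, (hU 0).2.trans (subset_iUnion _ _)⟩⟩
  obtain ⟨j, hj, hji⟩ := ht.surjOn (mem_range_self i)
  exact (hi j (hX hj)).ne hji

theorem isStationary_bounded {A : Type w} [Infinite A] {Ω : Type w} [LinearOrder Ω] [Uncountable Ω]
    (hΩ : ∀ i : Ω, (Iic i).Countable) {ρ : A → Ω} (hρ : Function.Surjective ρ) :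
    IsStationaryInCountable
      {X : Set A | X ∈ countablyInfiniteSets A ∧ ∃ i, ∀ j ∈ X, ρ j < ρ i} := by
  refine ⟨fun X hX => hX.1, fun C hC => ?_⟩
  obtain ⟨X, hX, -⟩ := hC.unbounded (range (Infinite.natEmbedding A))
    ⟨countable_range _, infinite_range_of_injective (Infinite.natEmbedding A).injective⟩
  obtain ⟨i, hi⟩ := exists_forall_lt_of_countable hΩ ((hC.subset hX).1.image ρ)
  obtain ⟨a, rfl⟩ := hρ i
  exact ⟨X, ⟨hC.subset hX, a, fun j hj => hi _ ⟨j, hj, rfl⟩⟩, hX⟩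

/-- Under the reflection principle almost every countable subset of `A` projects to a layer.
Otherwise the sets that do not would be stationary, and would reflect to a set `B` whose projection
to `W` is a proper initial segment; but almost every countable subset of `B` projects to a layer of
that segment. -/
theorem SDLSMinus.exists_club_image_eq_layer (h : SDLSMinus.{u, v, w} (ℵ_ 2)) {A W Ω : Type w}
    [LinearOrder W] [WellFoundedLT W] [LinearOrder Ω] [WellFoundedLT Ω] [Uncountable Ω]
    (hW : #W = ℵ_ 2) (hΩ : ∀ i : Ω, (Iic i).Countable)
    {f : W → W → Ω} (hf : ∀ β, InjOn (f β) (Iio β))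
    {π : A → W} (hπ : Function.Surjective π) {ρ : A → Ω} (hρ : Function.Surjective ρ)
    {code : A → ℕ → A} (hcode : Function.Surjective code) :
    ∃ C : Set (Set A), IsClubInCountable C ∧ ∀ X ∈ C, ∃ β i, π '' X = layer f β i := by
  have : Uncountable A := hρ.uncountable
  have hWne : Nonempty W := hρ.nonempty.map π
  have henum (β : W) (i : Ω) : ∃ g : ℕ → W, layer f β i ⊆ range g := by
    obtain hemp | hne := (layer f β i).eq_empty_or_nonempty
    · exact ⟨fun _ => hWne.some, by simp [hemp]⟩
    · obtain ⟨g, hg⟩ := (countable_layer hf hΩ β i).exists_eq_range hne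
      exact ⟨g, hg.le⟩
  choose enum henum using henum
  let R : Set A := {s | ¬ ∃ β i, π '' range (code s) = layer f β i}
  obtain ⟨B, hBcard, hBcode, hBinit, hBR, hBρ⟩ := h.exists_reflecting_set code
    (fun n a b => Function.surjInv hπ (enum (π a) (ρ b) n)) R (fun a b => ρ a < ρ b)
  have hBunc := not_countable_range_of_isStationary (fun b : B => ρ b)
    (hBρ (isStationary_bounded hΩ hρ))
  -- The projection is transitive: below `π a`, every point lies in the layer of `π a` at all large
  -- enough `ρ b`, and `B` is closed under the enumerations of these layers.
  have hlower : IsLowerSet (range fun b : B => π b) := by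
    rintro _ η hη ⟨a, rfl⟩
    obtain rfl | hlt := eq_or_lt_of_le hη
    · exact ⟨a, rfl⟩
    obtain ⟨_, ⟨b, rfl⟩, hb⟩ := exists_gt_of_uncountable hΩ hBunc (f (π a) η)
    obtain ⟨n, hn⟩ := henum (π a) (ρ b) ⟨hlt, hb⟩
    exact ⟨⟨_, hBinit a a.2 b b.2 n⟩, (Function.surjInv_eq hπ _).trans hn⟩
  have hne : (range fun b : B => π b) ≠ Set.univ := by
    intro heq
    have hle : #(range fun b : B => π b) ≤ #B := mk_range_le
    rw [heq, mk_univ, hW] at hle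
    exact hle.not_gt hBcard
  obtain ⟨β, hβ⟩ := exists_eq_Iio_of_isLowerSet hlower hne
  have hnot : ¬ IsStationaryInCountable {X : Set A | X ∈ countablyInfiniteSets A ∧
      ∃ s ∈ R, X = range (code s)} := by
    intro hstat
    obtain ⟨X, ⟨-, s, hsR, hXs⟩, -, i, hi⟩ :=
      (hBR hstat).2 _ (isClubInCountable_image_eq_layer hΩ hf hβ)
    refine hsR ⟨β, i, ?_⟩
    rw [← hXs, image_image, hi]
  have hnot' := not_and.1 hnot fun X hX => hX.1
  push Not at hnot'
  obtain ⟨C, hC, hCemp⟩ := hnot'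
  refine ⟨C, hC, fun X hX => ?_⟩
  by_contra hlayer
  obtain ⟨g, rfl⟩ := (hC.subset hX).1.exists_eq_range (hC.subset hX).2.nonempty
  obtain ⟨s, rfl⟩ := hcode g
  exact (eq_empty_iff_forall_notMem.1 hCemp _) ⟨⟨hC.subset hX, s, hlayer, rfl⟩, hX⟩

theorem mainTheorem11 (h : SDLSMinus.{u, v, w} (ℵ_ 2)) : (2 : Cardinal.{0}) ^ ℵ₀ ≤ ℵ_ 2 := by
  obtain ⟨W, _, _, hWcard, hW⟩ := exists_wellOrder_aleph_two.{w}
  obtain ⟨Ω, _, _, _, hΩcard, hΩ⟩ := exists_uncountable_wellOrder_countable_Iic.{w}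
  obtain ⟨f, hf⟩ := exists_injOn_Iio hW hΩcard
  have hlt : (ℵ₁ : Cardinal.{w}) < ℵ_ 2 := aleph_lt_aleph.2 one_lt_two
  have hWne : Nonempty W := mk_ne_zero_iff.1 (by rw [hWcard]; exact (aleph_pos 2).ne')
  have hΩne : Nonempty Ω := inferInstance
  -- Sequences provide codes of their own countable sequences by pairing; the first entry carries
  -- the projections to `W` and `Ω`.
  obtain ⟨C, hC, hCf⟩ := h.exists_club_image_eq_layer (A := ℕ → W × Ω) hWcard hΩ hf
    (π := fun a => (a 0).1) (fun β => ⟨fun _ => (β, hΩne.some), rfl⟩)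
    (ρ := fun a => (a 0).2) (fun i => ⟨fun _ => (hWne.some, i), rfl⟩)
    (code := fun a n m => a (Nat.pair n m))
    (fun g => ⟨fun k => g k.unpair.1 k.unpair.2, by simp⟩)
  obtain ⟨F, hF, hFC⟩ := exists_injective_images_of_club hC (fun a : ℕ → W × Ω => (a 0).1)
    (fun β => ⟨fun _ => (β, hΩne.some), rfl⟩) (by rw [hWcard]; exact hlt.not_ge)
  have hrange (b) : ∃ q : W × Ω, F b = layer f q.1 q.2 := by
    obtain ⟨X, hX, hFX⟩ := hFC b
    obtain ⟨β, i, hβ⟩ := hCf X hX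
    exact ⟨(β, i), hFX.trans hβ⟩
  choose q hq using hrange
  have hqinj : Function.Injective q := fun b b' hb => hF (by rw [hq, hq, hb])
  have hle := mk_le_of_injective
    (f := q ∘ ULift.down.{w}) (hqinj.comp ULift.down_injective)
  rw [mk_prod, hWcard, hΩcard, lift_id, lift_id, mul_eq_left (aleph0_le_aleph 2) hlt.le
    (aleph_pos 1).ne'] at hle
  rw [← Cardinal.lift_le.{w}]
  simpa using hle
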